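/- Conventions. Let $X$ be an arbitrary topological space. Paths are continuous maps $[0,1]\to X$, and $\simeq$ denotes homotopy of paths relative to the endpoints; restrictions to a subinterval $[a,b]$, $a<b$, are regarded as paths in the same sense. A set $A\subseteq[0,1]$ is a *homotopy cut-set* for paths $\alpha,\beta:[0,1]\to X$ if (i) $A$ is closed, nowhere dense and $\{0,1\}\subseteq A$; (ii) $\alpha|_A=\beta|_A$; (iii) $\alpha|_{[a,b]}\simeq\beta|_{[a,b]}$ for every connected component $(a,b)$ of $[0,1]\setminus A$. The space $X$ has *well-defined transfinite $\pi_1$-products* if for every $x\in X$ and any loops $\alpha,\beta:[0,1]\to X$ that have a homotopy cut-set $A$ with $\alpha(A)=\beta(A)=\{x\}$, we have $\alpha\simeq\beta$. A subset of $[0,1]$ is *perfect* if it is closed and has no isolated points, and $y$ is *isolated* in a subspace $S\subseteq X$ if $\{y\}$ is open in $S$. **Theorem.** Suppose $X$ has well-defined transfinite $\pi_1$-products, and let $A$ be a homotopy cut-set for paths $\alpha,\beta:[0,1]\to X$. Then either $\alpha\simeq\beta$, or there exists a non-empty perfect set $P\subseteq A$ such that 1. $B=P\cup\{0,1\}$ is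 a homotopy cut-set for $\alpha$ and $\beta$; 2. $\{t\in B\cap(0,1)\mid \alpha(t)\text{ is isolated in }\alpha(B)\}=\emptyset$. -/

import Mathlib

/-- A homotopy cut-set `A ⊆ [0,1]` for two paths `α, β : [0,1] → X`. Two paths admitting such a set
agree at `0` and `1`, so they are taken with common endpoints from the start. -/
structure IsHomotopyCutSet {X : Type*} [TopologicalSpace X] {x y : X} (α β : Path x y)
    (A : Set unitInterval) : Prop where
  isClosed : IsClosed A
  isNowhereDense : IsNowhereDense A
  zero_mem : (0 : unitInterval) ∈ A
  one_mem : (1 : unitInterval) ∈ A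
  eqOn : ∀ ⦃t : unitInterval⦄, t ∈ A → α t = β t
  /-- The components of `[0,1] \ A` are the intervals `(a,b)` with `a < b` in `A` that do not meet
  `A`; the restrictions to `[a,b]`, reparametrized affinely on `[0,1]`, are path-homotopic. -/
  homotopic : ∀ ⦃a b : unitInterval⦄ (ha : a ∈ A) (hb : b ∈ A), a < b →
    Disjoint (Set.Ioo a b) A →
      (α.subpath a b).Homotopic ((β.subpath a b).cast (eqOn ha) (eqOn hb))

/-- `X` has well-defined transfinite `π₁`-products: for every point `x`, any two loops
`α, β : ([0,1], A) → (X, x)` (the whole set `A` is sent to `x`) for which `A` is a homotopy cut-set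
are path-homotopic. -/
def HasWellDefinedTransfinitePi1Products (X : Type*) [TopologicalSpace X] : Prop :=
  ∀ (x : X) (α β : Path x x) (A : Set unitInterval),
    IsHomotopyCutSet α β A → (∀ t ∈ A, α t = x ∧ β t = x) → α.Homotopic β

/-- `y` is an isolated point of the subspace `S`: `{y}` is relatively open in `S`. -/
def IsIsolatedPointOf {X : Type*} [TopologicalSpace X] (S : Set X) (y : X) : Prop :=
  ∃ U : Set X, IsOpen U ∧ U ∩ S = {y}

open Set unitInterval Topology

/-! Call a point of `A` essential if arbitrarily near it there are two points of `A` between which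
`α` and `β` are not homotopic; `P` is the set of essential points, closed by its very form.

The main claim (`of_disjoint_Ioo`) is that `α` and `β` are homotopic between any two points of `A`
with no essential point strictly between them. On a compact interval free of essential points this
is a connectedness argument (`of_disjoint_Icc`). Endpoints are then added as limits
(`of_mem_closure`), the only part of the claim that needs the hypothesis on products. That
hypothesis concerns loops sending the whole cut-set to one point, whereas here the paths take
varying values at the points `1 / k`. So an excursion along `f` to `f 0` and back is inserted at
each `1 / k`; the resulting loops are homotopic by hypothesis, and contracting the excursions gives
the original paths (`zero_one_of_unitFrac`).

The claim gives everything else. If `P` is empty, `α ≃ β`. Otherwise `P ∪ {0, 1}` is a cut-set, and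
an isolated point of `P` would not be essential. If `α t` were isolated in the image of the new
cut-set, `α` would be constant on the part of that cut-set near `t`; the product hypothesis
(`of_const`) and the claim would then make `t` inessential. -/

/-- The restrictions of `f` and `g` to the segment from `a` to `b` are path-homotopic. -/
def SubpathHomotopic {X : Type*} [TopologicalSpace X] (f g : C(I, X)) (a b : I) : Prop :=
  ∃ (ha : f a = g a) (hb : f b = g b), ∀ γ : Path a b,
    (γ.map f.continuous).Homotopic ((γ.map g.continuous).cast ha hb)

theorem unitInterval.contractibleSpace : ContractibleSpace I :=
  (convex_Icc (0 : ℝ) 1).contractibleSpace ⟨0, by simp⟩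

theorem unitInterval.path_homotopic {a b : I} (γ γ' : Path a b) : γ.Homotopic γ' :=
  have := unitInterval.contractibleSpace
  SimplyConnectedSpace.paths_homotopic γ γ'

/-! ### Groupoid calculus of segments with homotopic restrictions -/

namespace SubpathHomotopic

variable {X : Type*} [TopologicalSpace X] {f g f' g' : C(I, X)} {a b c : I}

theorem of_path (ha : f a = g a) (hb : f b = g b) (γ : Path a b)
    (h : (γ.map f.continuous).Homotopic ((γ.map g.continuous).cast ha hb)) :
    SubpathHomotopic f g a b :=
  ⟨ha, hb, fun γ' =>
    ((unitInterval.path_homotopic γ' γ).map f).trans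
      (h.trans (((unitInterval.path_homotopic γ γ').map g).pathCast ha hb))⟩

/-- The path `t ↦ (1 - t) a + t b` in the unit interval. -/
noncomputable def line (a b : I) : Path a b where
  toFun := Icc.convexComb a b
  continuous_toFun := by
    exact Icc.continuous_convexComb_prod.comp (by fun_prop : Continuous fun t : I => (a, b, t))
  source' := by simp
  target' := by simp

theorem subpath_iff {x y : X} {α β : Path x y} (ha : α a = β a) (hb : α b = β b) :
    SubpathHomotopic (α : C(I, X)) (β : C(I, X)) a b ↔
      (α.subpath a b).Homotopic ((β.subpath a b).cast ha hb) :=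
  ⟨fun ⟨_, _, h⟩ => h (line a b), fun h => of_path ha hb (line a b) h⟩

theorem zero_one_iff {x y : X} {α β : Path x y} :
    SubpathHomotopic (α : C(I, X)) (β : C(I, X)) 0 1 ↔ α.Homotopic β := by
  have h0 : α 0 = β 0 := by simp
  have h1 : α 1 = β 1 := by simp
  rw [subpath_iff h0 h1, Path.subpath_zero_one, Path.subpath_zero_one]
  exact ⟨fun h => h.pathCast α.source.symm α.target.symm,
    fun h => h.pathCast α.source α.target⟩

theorem of_eqOn (h : EqOn f g (uIcc a b)) : SubpathHomotopic f g a b := by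
  refine of_path (h left_mem_uIcc) (h right_mem_uIcc) (line a b) ?_
  have : (line a b).map f.continuous =
      ((line a b).map g.continuous).cast (h left_mem_uIcc) (h right_mem_uIcc) := by
    ext t
    refine h ?_
    rw [← Path.range_subpathAux]
    exact mem_range_self t
  rw [this]

theorem congr (h : SubpathHomotopic f g a b) (hf : EqOn f' f (uIcc a b))
    (hg : EqOn g' g (uIcc a b)) : SubpathHomotopic f' g' a b := by
  obtain ⟨ha, hb, h⟩ := h
  have hl := left_mem_uIcc (a := a) (b := b)
  have hr := right_mem_uIcc (a := a) (b := b)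
  refine of_path (by rw [hf hl, hg hl, ha]) (by rw [hf hr, hg hr, hb]) (line a b) ?_
  have key := (h (line a b)).pathCast (hf hl) (hf hr)
  have hmem : ∀ t, line a b t ∈ uIcc a b := fun t => by
    rw [← Path.range_subpathAux]
    exact mem_range_self t
  convert key using 1
  · ext t
    exact hf (hmem t)
  · ext t
    exact hg (hmem t)

theorem refl (ha : f a = g a) : SubpathHomotopic f g a a :=
  of_eqOn (by simpa using ha)

theorem symm (h : SubpathHomotopic f g a b) : SubpathHomotopic f g b a := by
  obtain ⟨ha, hb, h⟩ := h
  exact of_path hb ha (line a b).symm (h (line a b)).symm₂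

theorem trans (h : SubpathHomotopic f g a b) (h' : SubpathHomotopic f g b c) :
    SubpathHomotopic f g a c := by
  obtain ⟨ha, hb, h⟩ := h
  obtain ⟨_, hc, h'⟩ := h'
  refine of_path ha hc ((line a b).trans (line b c)) ?_
  rw [Path.map_trans, Path.map_trans, Path.cast_trans _ _ ha hb hc]
  exact (h _).hcomp (h' _)

/-- Since the interval is simply connected, only the endpoints `φ a`, `φ b` matter; `φ` need not be
monotone. This is how plateaus, clamps and interpolating maps are removed. -/
theorem comp_iff {φ : C(I, I)} :
    SubpathHomotopic (f.comp φ) (g.comp φ) a b ↔ SubpathHomotopic f g (φ a) (φ b) :=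
  ⟨fun ⟨ha, hb, h⟩ => of_path ha hb ((line a b).map φ.continuous) (h (line a b)),
    fun ⟨ha, hb, h⟩ => of_path ha hb (line a b) (h ((line a b).map φ.continuous))⟩

/-- If two squares `K` and `K'` agree along the bottom and top sides and have homotopic left sides,
then they have homotopic right sides. -/
theorem of_square {K K' : C(I × I, X)} (h0 : ∀ s, K (s, 0) = K' (s, 0))
    (h1 : ∀ s, K (s, 1) = K' (s, 1))
    (h : SubpathHomotopic (K.comp ⟨fun t => (0, t), by fun_prop⟩)
      (K'.comp ⟨fun t => (0, t), by fun_prop⟩) 0 1) :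
    SubpathHomotopic (K.comp ⟨fun t => (1, t), by fun_prop⟩)
      (K'.comp ⟨fun t => (1, t), by fun_prop⟩) 0 1 := by
  have := unitInterval.contractibleSpace
  let bottom : Path ((1 : I), (0 : I)) (0, 0) := (line 1 0).map (f := fun s => (s, 0)) (by fun_prop)
  let left : Path ((0 : I), (0 : I)) (0, 1) := (line 0 1).map (f := fun s => (0, s)) (by fun_prop)
  let top : Path ((0 : I), (1 : I)) (1, 1) := (line 0 1).map (f := fun s => (s, 1)) (by fun_prop)
  let right : Path ((1 : I), (0 : I)) (1, 1) := (line 0 1).map (f := fun s => (1, s)) (by fun_prop)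
  have hq : right.Homotopic (bottom.trans (left.trans top)) :=
    SimplyConnectedSpace.paths_homotopic _ _
  have hleft : (left.map K.continuous).Homotopic
      ((left.map K'.continuous).cast (h0 0) (h1 0)) := by
    obtain ⟨_, _, h⟩ := h
    exact h (line 0 1)
  have hbottom : bottom.map K.continuous =
      (bottom.map K'.continuous).cast (h0 1) (h0 0) := by
    ext s
    exact h0 _
  have htop : top.map K.continuous = (top.map K'.continuous).cast (h1 0) (h1 1) := by
    ext s
    exact h1 _
  refine of_path (h0 1) (h1 1) (line 0 1) ?_
  have hK := hq.map K
  have hK' := (hq.map K').pathCast (h0 1) (h1 1)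
  refine (hK.trans ?_).trans hK'.symm
  rw [Path.map_trans, Path.map_trans, Path.map_trans, Path.map_trans,
    Path.cast_trans _ _ (h0 1) (h0 0) (h1 1), Path.cast_trans _ _ (h0 0) (h1 0) (h1 1),
    hbottom, htop]
  exact (Path.Homotopic.refl _).hcomp (hleft.hcomp (Path.Homotopic.refl _))

end SubpathHomotopic

/-! ### Auxiliary functions oscillating along the points `1 / k` -/

/-- The factor `t` damps the bounded oscillation at `0`, where the convention `0⁻¹ = 0` is harmless.
-/
theorem continuous_mul_comp_inv {b : ℝ → ℝ} (hb : Continuous b) {C : ℝ} (hC : ∀ x, |b x| ≤ C) :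
    Continuous fun t : ℝ => t * b t⁻¹ := by
  rw [continuous_iff_continuousAt]
  intro t
  rcases eq_or_ne t 0 with rfl | ht
  · have h : Filter.Tendsto (fun t : ℝ => |t| * C) (𝓝 0) (𝓝 0) := by
      have : Continuous fun t : ℝ => |t| * C := by fun_prop
      simpa using this.tendsto 0
    rw [ContinuousAt, zero_mul]
    refine squeeze_zero_norm (fun s => ?_) h
    rw [norm_mul, Real.norm_eq_abs, Real.norm_eq_abs]
    exact mul_le_mul_of_nonneg_left (hC _) (abs_nonneg _)
  · exact continuousAt_id.mul (hb.continuousAt.comp (continuousAt_inv₀ ht))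

theorem cos_two_pi_mul_sub_natCast (x : ℝ) (k : ℕ) :
    Real.cos (2 * Real.pi * (x - k)) = Real.cos (2 * Real.pi * x) := by
  rw [← Real.cos_sub_nat_mul_two_pi (2 * Real.pi * x) k]
  ring_nf

theorem cos_two_pi_mul_nonneg {x : ℝ} {k : ℕ} (h : |x - k| ≤ 1 / 4) :
    0 ≤ Real.cos (2 * Real.pi * x) := by
  rw [← cos_two_pi_mul_sub_natCast x k]
  rw [abs_le] at h
  have := Real.pi_pos
  exact Real.cos_nonneg_of_mem_Icc ⟨by nlinarith, by nlinarith⟩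

theorem cos_two_pi_mul_nonpos {x : ℝ} {k : ℕ} (h₁ : k + 1 / 4 ≤ x) (h₂ : x ≤ k + 3 / 4) :
    Real.cos (2 * Real.pi * x) ≤ 0 := by
  rw [← cos_two_pi_mul_sub_natCast x k]
  have := Real.pi_pos
  exact Real.cos_nonpos_of_pi_div_two_le_of_le (by nlinarith) (by nlinarith)

theorem exists_natCast_near_of_cos_nonneg {x : ℝ} (hx : 1 ≤ x)
    (h : 0 ≤ Real.cos (2 * Real.pi * x)) : ∃ k : ℕ, |x - (k + 1 : ℕ)| ≤ 1 / 4 := by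
  have hpi := Real.pi_pos
  set k := ⌊x⌋₊ with hk
  have h1 : (k : ℝ) ≤ x := Nat.floor_le (by linarith)
  have h2 : x < k + 1 := Nat.lt_floor_add_one x
  have hk1 : 1 ≤ k := Nat.le_floor (by simpa using hx)
  rcases le_or_gt x (k + 1 / 4) with h3 | h3
  · refine ⟨k - 1, ?_⟩
    rw [Nat.sub_add_cancel hk1, abs_le]
    constructor <;> linarith
  rcases lt_or_ge x (k + 3 / 4) with h4 | h4
  · rw [← cos_two_pi_mul_sub_natCast x k] at h
    have := Real.cos_neg_of_pi_div_two_lt_of_lt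
      (x := 2 * Real.pi * (x - k)) (by nlinarith) (by nlinarith)
    linarith
  · refine ⟨k, ?_⟩
    push_cast
    rw [abs_le]
    constructor <;> linarith

theorem arcsin_sin_two_pi_mul {x : ℝ} {k : ℕ} (h : |x - k| ≤ 1 / 4) :
    Real.arcsin (Real.sin (2 * Real.pi * x)) = 2 * Real.pi * (x - k) := by
  have hpi := Real.pi_pos
  have : Real.sin (2 * Real.pi * x) = Real.sin (2 * Real.pi * (x - k)) := by
    rw [← Real.sin_sub_nat_mul_two_pi (2 * Real.pi * x) k]
    ring_nf
  rw [abs_le] at h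
  rw [this, Real.arcsin_sin (by nlinarith) (by nlinarith)]

/-- The point `1 / (n + 1)` of the unit interval. -/
noncomputable def unitFrac (n : ℕ) : I :=
  ⟨((n + 1 : ℕ) : ℝ)⁻¹, by positivity, by
    rw [inv_le_one₀ (by positivity)]; simp⟩

theorem unitFrac_zero : unitFrac 0 = 1 := by
  ext; simp [unitFrac]

theorem unitFrac_pos (n : ℕ) : 0 < unitFrac n := by
  rw [← Subtype.coe_lt_coe]
  simp only [unitFrac, Icc.coe_zero]
  positivity

theorem unitFrac_strictAnti : StrictAnti unitFrac := fun m n h => by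
  rw [← Subtype.coe_lt_coe]
  simp only [unitFrac]
  gcongr

theorem abs_arcsin_div_two_pi_le (x : ℝ) : |Real.arcsin x / (2 * Real.pi)| ≤ 1 / 4 := by
  have hpi := Real.pi_pos
  rw [abs_div, abs_of_pos (by positivity : 0 < 2 * Real.pi), div_le_iff₀ (by positivity)]
  have := abs_le.2 ⟨Real.neg_pi_div_two_le_arcsin x, Real.arcsin_le_pi_div_two x⟩
  linarith

theorem plateau_denom_pos (t : I) (x : ℝ) :
    3 / 4 ≤ 1 - t * (Real.arcsin x / (2 * Real.pi)) := by
  have := (abs_le.1 (abs_arcsin_div_two_pi_le x)).2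
  nlinarith [t.2.1, t.2.2]

/-- The continuous map `I → I` which is constant with value `1 / k` on
`{t | |t⁻¹ - k| ≤ 1 / 4}`. -/
noncomputable def plateau : C(I, I) where
  toFun t := projIcc 0 1 zero_le_one
    ((t : ℝ) / (1 - t * (Real.arcsin (Real.sin (2 * Real.pi * (t : ℝ)⁻¹)) / (2 * Real.pi))))
  continuous_toFun := by
    have hb : Continuous fun t : ℝ => t *
        (Real.arcsin (Real.sin (2 * Real.pi * t⁻¹)) / (2 * Real.pi)) :=
      continuous_mul_comp_inv
        (b := fun x => Real.arcsin (Real.sin (2 * Real.pi * x)) / (2 * Real.pi))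
        ((Real.continuous_arcsin.comp (by fun_prop)).div_const _)
        fun x => abs_arcsin_div_two_pi_le _
    have hb' := hb.comp (continuous_subtype_val : Continuous (Subtype.val : I → ℝ))
    refine continuous_projIcc.comp (continuous_subtype_val.div (continuous_const.sub hb') ?_)
    intro t
    have := plateau_denom_pos t (Real.sin (2 * Real.pi * (t : ℝ)⁻¹))
    exact (by linarith : (0 : ℝ) < _).ne'

/-- A continuous map `I → I` with zeros at the points `1 / k`, which agrees with `plateau` away from
them. -/
noncomputable def toothed : C(I, I) where
  toFun t := min (plateau t) (projIcc 0 1 zero_le_one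
    (2 * (t * min 1 (1 - Real.cos (2 * Real.pi * (t : ℝ)⁻¹)))))
  continuous_toFun := by
    have h : Continuous fun t : ℝ => t * min 1 (1 - Real.cos (2 * Real.pi * t⁻¹)) :=
      continuous_mul_comp_inv (b := fun x => min 1 (1 - Real.cos (2 * Real.pi * x)))
        (by fun_prop) (C := 1) fun x => by
          rw [abs_of_nonneg (le_min zero_le_one (sub_nonneg.2 (Real.cos_le_one _)))]
          exact min_le_left _ _
    have := h.comp (continuous_subtype_val : Continuous (Subtype.val : I → ℝ))
    exact plateau.continuous.min (continuous_projIcc.comp (this.const_mul 2))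

/-- The sign of `phase t` tells whether `t` is close to one of the points `1 / k`. -/
noncomputable def phase : C(I, ℝ) where
  toFun t := t * Real.cos (2 * Real.pi * (t : ℝ)⁻¹)
  continuous_toFun :=
    (continuous_mul_comp_inv (b := fun x => Real.cos (2 * Real.pi * x)) (by fun_prop)
      fun x => Real.abs_cos_le_one _).comp (continuous_subtype_val : Continuous (Subtype.val : I → ℝ))

theorem plateau_zero : plateau 0 = 0 := by
  simp [plateau]

theorem toothed_zero : toothed 0 = 0 := by
  simp [toothed, plateau_zero]

theorem plateau_eq {t : I} (ht : 0 < t) {k : ℕ} (h : |(t : ℝ)⁻¹ - (k + 1 : ℕ)| ≤ 1 / 4) :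
    plateau t = unitFrac k := by
  have ht' : (0 : ℝ) < t := ht
  have hpi := Real.pi_pos
  have : (t : ℝ) / (1 - t * (Real.arcsin (Real.sin (2 * Real.pi * (t : ℝ)⁻¹)) / (2 * Real.pi))) =
      unitFrac k := by
    rw [arcsin_sin_two_pi_mul h]
    have : (1 : ℝ) - t * (2 * Real.pi * ((t : ℝ)⁻¹ - (k + 1 : ℕ)) / (2 * Real.pi)) =
      t * (k + 1 : ℕ) := by field_simp; ring
    rw [this]
    simp only [unitFrac]
    field_simp
  simp only [plateau, ContinuousMap.coe_mk, this, projIcc_val]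

theorem plateau_of_phase_nonneg {t : I} (h : 0 ≤ phase t) :
    plateau t = 0 ∨ ∃ n, plateau t = unitFrac n := by
  rcases eq_or_lt_of_le (nonneg' : 0 ≤ t) with rfl | ht
  · exact Or.inl plateau_zero
  · have ht' : (0 : ℝ) < t := ht
    obtain ⟨k, hk⟩ := exists_natCast_near_of_cos_nonneg ((one_le_inv₀ ht').2 t.2.2)
      (nonneg_of_mul_nonneg_right h ht')
    exact Or.inr ⟨k, plateau_eq ht hk⟩

theorem toothed_le_plateau (t : I) : toothed t ≤ plateau t := min_le_left _ _

theorem toothed_of_phase_nonpos {t : I} (h : phase t ≤ 0) : toothed t = plateau t := by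
  rcases eq_or_lt_of_le (nonneg' : 0 ≤ t) with rfl | ht
  · rw [plateau_zero, toothed_zero]
  · have ht' : (0 : ℝ) < t := ht
    have hcos : Real.cos (2 * Real.pi * (t : ℝ)⁻¹) ≤ 0 := nonpos_of_mul_nonpos_right h ht'
    refine min_eq_left (monotone_projIcc _ ?_)
    have hd := plateau_denom_pos t (Real.sin (2 * Real.pi * (t : ℝ)⁻¹))
    -- The denominator is at least `3 / 4`, so `plateau t` is at most `4 t / 3`, below the cap `2
    -- t`; this is why `toothed` carries the factor `2`.
    rw [min_eq_left (by linarith), div_le_iff₀ (by linarith)]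
    nlinarith

theorem plateau_unitFrac (n : ℕ) : plateau (unitFrac n) = unitFrac n :=
  plateau_eq (unitFrac_pos n) (by simp [unitFrac])

theorem toothed_unitFrac (n : ℕ) : toothed (unitFrac n) = 0 := by
  have : Real.cos (2 * Real.pi * (unitFrac n : ℝ)⁻¹) = 1 := by
    rw [unitFrac, inv_inv, mul_comm]
    exact Real.cos_nat_mul_two_pi _
  simp [toothed, this]

theorem exists_phase_partition (n : ℕ) : ∃ l r : I, unitFrac (n + 1) ≤ l ∧ l ≤ r ∧ r ≤ unitFrac n ∧
    plateau l = unitFrac (n + 1) ∧ plateau r = unitFrac n ∧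
    (∀ t ∈ Icc (unitFrac (n + 1)) l, 0 ≤ phase t) ∧ (∀ t ∈ Icc l r, phase t ≤ 0) ∧
    (∀ t ∈ Icc r (unitFrac n), 0 ≤ phase t) := by
  have hn : (0 : ℝ) ≤ n := n.cast_nonneg
  have key (x : ℝ) (hx : 1 ≤ x) : x⁻¹ ∈ I := ⟨by positivity, inv_le_one_of_one_le₀ hx⟩
  have hpos {s t : I} (hs : 0 < s) (h : s ≤ t) : (0 : ℝ) < t := hs.trans_le h
  have hl : 0 < (⟨((n : ℝ) + 7 / 4)⁻¹, key _ (by linarith)⟩ : I) :=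
    Subtype.coe_lt_coe.1 (by rw [Icc.coe_zero]; positivity)
  have hr : 0 < (⟨((n : ℝ) + 5 / 4)⁻¹, key _ (by linarith)⟩ : I) :=
    Subtype.coe_lt_coe.1 (by rw [Icc.coe_zero]; positivity)
  -- In the variable `t⁻¹`, the cosine changes sign a quarter before `n + 2` and a quarter after `n
  -- + 1`.
  refine ⟨⟨((n : ℝ) + 7 / 4)⁻¹, key _ (by linarith)⟩, ⟨((n : ℝ) + 5 / 4)⁻¹, key _ (by linarith)⟩,
    ?_, ?_, ?_, ?_, ?_, ?_, ?_, ?_⟩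
  · rw [← Subtype.coe_le_coe]
    simp only [unitFrac]
    gcongr
    push_cast
    linarith
  · rw [← Subtype.coe_le_coe]
    simp only
    gcongr
    norm_num
  · rw [← Subtype.coe_le_coe]
    simp only [unitFrac]
    gcongr
    push_cast
    linarith
  · refine plateau_eq hl ?_
    rw [inv_inv, abs_le]
    push_cast
    constructor <;> linarith
  · refine plateau_eq hr ?_
    rw [inv_inv, abs_le]
    push_cast
    constructor <;> linarith
  · rintro t ⟨h1, h2⟩
    have ht := hpos (unitFrac_pos _) h1
    rw [← Subtype.coe_le_coe] at h1 h2
    refine mul_nonneg ht.le (cos_two_pi_mul_nonneg (k := n + 2) ?_)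
    have h3 := inv_anti₀ (unitFrac_pos _) h1
    have h4 := inv_anti₀ ht h2
    simp only [unitFrac, inv_inv] at h3 h4
    push_cast at h3 ⊢
    rw [abs_le]
    constructor <;> linarith
  · rintro t ⟨h1, h2⟩
    have ht := hpos hl h1
    rw [← Subtype.coe_le_coe] at h1 h2
    have h3 := inv_anti₀ (by positivity) h1
    have h4 := inv_anti₀ ht h2
    simp only [inv_inv] at h3 h4
    refine mul_nonpos_of_nonneg_of_nonpos ht.le (cos_two_pi_mul_nonpos (k := n + 1) ?_ ?_) <;>
    · push_cast
      linarith
  · rintro t ⟨h1, h2⟩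
    have ht := hpos hr h1
    rw [← Subtype.coe_le_coe] at h1 h2
    refine mul_nonneg ht.le (cos_two_pi_mul_nonneg (k := n + 1) ?_)
    have h3 := inv_anti₀ (by positivity) h1
    have h4 := inv_anti₀ ht h2
    simp only [unitFrac, inv_inv] at h3 h4
    push_cast at h4 ⊢
    rw [abs_le]
    constructor <;> linarith

theorem tendsto_unitFrac : Filter.Tendsto unitFrac Filter.atTop (𝓝 0) := by
  rw [tendsto_subtype_rng]
  exact (tendsto_inv_atTop_nhds_zero_nat (𝕜 := ℝ)).comp (Filter.tendsto_add_atTop_nat 1)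

theorem isClosed_unitFrac : IsClosed (insert 0 (range unitFrac)) := by
  exact tendsto_unitFrac.isCompact_insert_range.isClosed

theorem isNowhereDense_unitFrac : IsNowhereDense (insert 0 (range unitFrac)) := by
  rw [isClosed_unitFrac.isNowhereDense_iff, eq_empty_iff_forall_notMem]
  intro t ht
  obtain ⟨a, b, hab, h⟩ := isOpen_interior.exists_Ioo_subset ⟨t, ht⟩
  have h0 := (((countable_range unitFrac).insert 0).mono
    (h.trans interior_subset)).measure_zero MeasureTheory.volume
  rw [unitInterval.volume_Ioo, ENNReal.ofReal_eq_zero, sub_nonpos] at h0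
  exact hab.not_ge h0

/-! ### The excursion homotopy and interpolation through `1 / k` -/

section

variable {X : Type*} [TopologicalSpace X]

/-- For maps `f`, `g` that agree at `0` and at the points `1 / k`, the homotopy which starts at the
map following `g` between consecutive points `1 / (k + 1)` and `1 / k` and travelling along `f` to
`0` and back at each such point, and which shortens these excursions until they disappear. -/
noncomputable def excursionHomotopy (f g : C(I, X)) (h0 : f 0 = g 0)
    (hu : ∀ n, f (unitFrac n) = g (unitFrac n)) : C(I × I, X) where
  toFun p := if phase p.2 ≤ 0 then g (plateau p.2)
    else f (max (toothed p.2) (min p.1 (plateau p.2)))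
  continuous_toFun := by
    refine Continuous.if_le (by fun_prop) (by fun_prop) (by fun_prop) (by fun_prop) ?_
    intro p hp
    rw [toothed_of_phase_nonpos hp.le, max_eq_left (min_le_right _ _)]
    rcases plateau_of_phase_nonneg hp.ge with h | ⟨n, h⟩
    · rw [h, h0]
    · rw [h, hu]

section

variable {f g : C(I, X)} (h0 : f 0 = g 0) (hu : ∀ n, f (unitFrac n) = g (unitFrac n))

theorem excursionHomotopy_of_nonpos (s : I) {t : I} (ht : phase t ≤ 0) :
    excursionHomotopy f g h0 hu (s, t) = g (plateau t) :=
  if_pos ht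

theorem excursionHomotopy_of_nonneg (s : I) {t : I} (ht : 0 ≤ phase t) :
    excursionHomotopy f g h0 hu (s, t) = f (max (toothed t) (min s (plateau t))) := by
  rcases eq_or_lt_of_le ht with h | h
  · rw [excursionHomotopy_of_nonpos h0 hu s h.ge, toothed_of_phase_nonpos h.ge,
      max_eq_left (min_le_right _ _)]
    rcases plateau_of_phase_nonneg ht with h | ⟨n, h⟩
    · rw [h, h0]
    · rw [h, hu]
  · exact if_neg h.not_ge

theorem excursionHomotopy_zero (s : I) : excursionHomotopy f g h0 hu (s, 0) = f 0 := by
  rw [excursionHomotopy_of_nonneg h0 hu s (by simp [phase]), toothed_zero, plateau_zero]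
  simp

theorem excursionHomotopy_unitFrac (s : I) (n : ℕ) :
    excursionHomotopy f g h0 hu (s, unitFrac n) = f (min s (unitFrac n)) := by
  obtain ⟨l, r, h1, h2, h3, -, -, -, -, h⟩ := exists_phase_partition n
  rw [excursionHomotopy_of_nonneg h0 hu s (h _ ⟨h3, le_rfl⟩), toothed_unitFrac, plateau_unitFrac,
    max_eq_right nonneg']

theorem excursionHomotopy_top (t : I) : excursionHomotopy f g h0 hu (1, t) = g (plateau t) := by
  rcases le_total (phase t) 0 with h | h
  · exact excursionHomotopy_of_nonpos h0 hu 1 h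
  · rw [excursionHomotopy_of_nonneg h0 hu 1 h, min_eq_right le_one',
      max_eq_right (toothed_le_plateau t)]
    rcases plateau_of_phase_nonneg h with h | ⟨n, h⟩
    · rw [h, h0]
    · rw [h, hu]

end

theorem exists_unitFrac_eq_of_disjoint {a b : I} (ha : a ∈ insert 0 (range unitFrac))
    (hb : b ∈ insert 0 (range unitFrac)) (hab : a < b)
    (h : Disjoint (Ioo a b) (insert 0 (range unitFrac))) :
    ∃ n, a = unitFrac (n + 1) ∧ b = unitFrac n := by
  rw [disjoint_left] at h
  rcases hb with rfl | ⟨n, rfl⟩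
  · exact absurd hab nonneg'.not_gt
  refine ⟨n, ?_, rfl⟩
  by_contra hne
  have hlt := unitFrac_strictAnti (Nat.lt_succ_self n)
  rcases ha with rfl | ⟨m, rfl⟩
  · exact h ⟨unitFrac_pos (n + 1), hlt⟩ (Or.inr ⟨_, rfl⟩)
  · have hm : n < m := unitFrac_strictAnti.lt_iff_gt.1 hab
    have hm' : n + 1 ≠ m := fun e => hne (by rw [e])
    exact h ⟨unitFrac_strictAnti (by omega), hlt⟩ (Or.inr ⟨n + 1, rfl⟩)

/-- The points `1 / k` together with `0` form a closed copy of the one-point compactification of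
`ℕ`, so Tietze extension applies; clamping brings the values back into `I`. -/
theorem exists_continuousMap_unitFrac {p : I} {v : ℕ → I}
    (hv : Filter.Tendsto v Filter.atTop (𝓝 p)) :
    ∃ θ : C(I, I), θ 0 = p ∧ ∀ n, θ (unitFrac n) = v n := by
  have hu : IsClosedEmbedding (OnePoint.continuousMapMkNat unitFrac 0 tendsto_unitFrac) := by
    refine (map_continuous _).isClosedEmbedding ?_
    intro x y h
    induction x using OnePoint.rec <;> induction y using OnePoint.rec
    · rfl
    · exact absurd h (unitFrac_pos _).ne
    · exact absurd h (unitFrac_pos _).ne'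
    · exact congrArg _ (unitFrac_strictAnti.injective h)
  obtain ⟨G, hG⟩ := ContinuousMap.exists_extension hu
    (((⟨Subtype.val, continuous_subtype_val⟩ : C(I, ℝ))).comp (OnePoint.continuousMapMkNat v p hv))
  refine ⟨⟨fun t => projIcc 0 1 zero_le_one (G t), by fun_prop⟩, ?_, fun n => ?_⟩
  · have : G 0 = p := DFunLike.congr_fun hG OnePoint.infty
    simp [this]
  · have : G (unitFrac n) = v n := DFunLike.congr_fun hG (n : OnePoint ℕ)
    simp [this]

/-! ### Passing to limits with transfinite products -/

namespace SubpathHomotopic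

/-- Both maps make their excursions along `f`, so they coincide where `phase` is nonnegative; on the
middle piece they are reparametrizations of `f` and `g` over the whole gap. -/
theorem excursion_step {f g : C(I, X)} (h0 : f 0 = g 0)
    (hu : ∀ n, f (unitFrac n) = g (unitFrac n)) (n : ℕ)
    (h : SubpathHomotopic f g (unitFrac (n + 1)) (unitFrac n)) :
    SubpathHomotopic
      ((excursionHomotopy f f rfl fun _ => rfl).comp ⟨fun t => (0, t), by fun_prop⟩)
      ((excursionHomotopy f g h0 hu).comp ⟨fun t => (0, t), by fun_prop⟩)
      (unitFrac (n + 1)) (unitFrac n) := by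
  obtain ⟨l, r, hl, hlr, hr, pl, pr, h1, h2, h3⟩ := exists_phase_partition n
  refine (of_eqOn ?_).trans (b := l) (trans (b := r) ?_ (of_eqOn ?_))
  · rw [uIcc_of_le hl]
    intro t ht
    exact (excursionHomotopy_of_nonneg rfl (fun _ => rfl) 0 (h1 t ht)).trans
      (excursionHomotopy_of_nonneg h0 hu 0 (h1 t ht)).symm
  · refine congr (f := f.comp plateau) (g := g.comp plateau) (comp_iff.2 (by rwa [pl, pr])) ?_ ?_
    · rw [uIcc_of_le hlr]
      intro t ht
      exact excursionHomotopy_of_nonpos rfl (fun _ => rfl) 0 (h2 t ht)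
    · rw [uIcc_of_le hlr]
      intro t ht
      exact excursionHomotopy_of_nonpos h0 hu 0 (h2 t ht)
  · rw [uIcc_of_le hr]
    intro t ht
    exact (excursionHomotopy_of_nonneg rfl (fun _ => rfl) 0 (h3 t ht)).trans
      (excursionHomotopy_of_nonneg h0 hu 0 (h3 t ht)).symm

/-- The product hypothesis, stated for `SubpathHomotopic`. -/
theorem of_hasWellDefinedTransfinitePi1Products
    (hX : HasWellDefinedTransfinitePi1Products X) {f g : C(I, X)} {x : X} {A : Set I}
    (hA : IsClosed A) (hA' : IsNowhereDense A) (h0 : 0 ∈ A) (h1 : 1 ∈ A)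
    (hf : ∀ t ∈ A, f t = x) (hg : ∀ t ∈ A, g t = x)
    (h : ∀ a ∈ A, ∀ b ∈ A, a < b → Disjoint (Ioo a b) A → SubpathHomotopic f g a b) :
    SubpathHomotopic f g 0 1 := by
  let α : Path x x := ⟨f, hf 0 h0, hf 1 h1⟩
  let β : Path x x := ⟨g, hg 0 h0, hg 1 h1⟩
  have hE : ∀ ⦃t⦄, t ∈ A → α t = β t := fun t ht => (hf t ht).trans (hg t ht).symm
  refine (zero_one_iff (α := α) (β := β)).2 (hX x α β A ⟨hA, hA', h0, h1, hE, ?_⟩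
    fun t ht => ⟨hf t ht, hg t ht⟩)
  intro a b ha hb hab hd
  exact (subpath_iff (hE ha) (hE hb)).1 (h a ha b hb hab hd)

theorem zero_one_of_unitFrac (hX : HasWellDefinedTransfinitePi1Products X) {f g : C(I, X)}
    (h0 : f 0 = g 0) (h : ∀ n, SubpathHomotopic f g (unitFrac (n + 1)) (unitFrac n)) :
    SubpathHomotopic f g 0 1 := by
  have hu : ∀ n, f (unitFrac n) = g (unitFrac n) := fun n => (h n).choose_spec.choose
  have hloop : ∀ (g : C(I, X)) (h0 : f 0 = g 0) (hu : ∀ n, f (unitFrac n) = g (unitFrac n)),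
      ∀ t ∈ insert 0 (range unitFrac), excursionHomotopy f g h0 hu (0, t) = f 0 := by
    rintro g h0 hu t (rfl | ⟨n, rfl⟩)
    · exact excursionHomotopy_zero h0 hu 0
    · rw [excursionHomotopy_unitFrac, min_eq_left nonneg']
  have hleft := of_hasWellDefinedTransfinitePi1Products hX isClosed_unitFrac
    isNowhereDense_unitFrac (mem_insert _ _) (Or.inr ⟨0, unitFrac_zero⟩)
    (f := (excursionHomotopy f f rfl fun _ => rfl).comp ⟨fun t => (0, t), by fun_prop⟩)
    (g := (excursionHomotopy f g h0 hu).comp ⟨fun t => (0, t), by fun_prop⟩)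
    (hloop f rfl fun _ => rfl) (hloop g h0 hu) fun a ha b hb hab hd => by
      obtain ⟨n, rfl, rfl⟩ := exists_unitFrac_eq_of_disjoint ha hb hab hd
      exact excursion_step h0 hu n (h n)
  -- The sides `t = 0` and `t = 1` of the homotopy depend on `f` alone, so the squares built from
  -- `(f, f)` and `(f, g)` share them.
  have hright := of_square
    (fun s => (excursionHomotopy_zero rfl _ s).trans (excursionHomotopy_zero h0 hu s).symm)
    (fun s => by rw [← unitFrac_zero, excursionHomotopy_unitFrac, excursionHomotopy_unitFrac]) hleft
  have := comp_iff.1 (hright.congr (f' := f.comp plateau) (g' := g.comp plateau)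
    (fun t _ => (excursionHomotopy_top rfl (fun _ => rfl) t).symm)
    (fun t _ => (excursionHomotopy_top h0 hu t).symm))
  rwa [plateau_zero, ← unitFrac_zero, plateau_unitFrac, unitFrac_zero] at this

/-- A sequence in `S` tending to `p`, not necessarily monotone, is threaded by a map `θ`, reducing
to the case of the points `1 / k`. -/
theorem of_mem_closure (hX : HasWellDefinedTransfinitePi1Products X) {f g : C(I, X)} {S : Set I}
    {p a : I} (hp : p ∈ closure S) (hfg : f p = g p)
    (hS : ∀ b ∈ S, ∀ c ∈ S, SubpathHomotopic f g b c) (ha : a ∈ S) :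
    SubpathHomotopic f g p a := by
  obtain ⟨v, hv, hlim⟩ := mem_closure_iff_seq_limit.1 hp
  obtain ⟨θ, hθ, hθn⟩ := exists_continuousMap_unitFrac
    -- The sequence is shifted to begin with `a`, so that `θ 1 = a`.
    (v := fun n => Nat.casesOn n a v) (p := p)
    ((Filter.tendsto_add_atTop_iff_nat 1).1 hlim)
  have hmem : ∀ n, θ (unitFrac n) ∈ S := by
    rintro (_ | n)
    · rw [hθn]
      exact ha
    · rw [hθn]
      exact hv n
  have := comp_iff.1 (zero_one_of_unitFrac hX (f := f.comp θ) (g := g.comp θ)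
    (by simpa [hθ] using hfg) fun n => comp_iff.2 (hS _ (hmem _) _ (hmem _)))
  rwa [hθ, ← unitFrac_zero, hθn] at this

end SubpathHomotopic

/-! ### Essential points -/

/-- The points every neighbourhood of which contains points `a`, `b` of `A` such that the
restrictions of `f` and `g` to the segment from `a` to `b` are not homotopic. -/
def essentialPoints (f g : C(I, X)) (A : Set I) : Set I :=
  {t | ∀ V ∈ 𝓝 t, ∃ a ∈ A ∩ V, ∃ b ∈ A ∩ V, ¬SubpathHomotopic f g a b}

theorem notMem_essentialPoints {f g : C(I, X)} {A : Set I} {t : I} :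
    t ∉ essentialPoints f g A ↔
      ∃ V ∈ 𝓝 t, ∀ a ∈ A ∩ V, ∀ b ∈ A ∩ V, SubpathHomotopic f g a b := by
  simp only [essentialPoints, mem_ofPred_eq]
  push Not
  rfl

theorem isClosed_essentialPoints (f g : C(I, X)) (A : Set I) :
    IsClosed (essentialPoints f g A) := by
  rw [← isOpen_compl_iff, isOpen_iff_mem_nhds]
  intro t ht
  obtain ⟨V, hV, h⟩ := notMem_essentialPoints.1 ht
  filter_upwards [eventually_mem_nhds_iff.2 hV] with s hs
  exact notMem_essentialPoints.2 ⟨V, hs, h⟩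

theorem essentialPoints_subset (f g : C(I, X)) {A : Set I} (hA : IsClosed A) :
    essentialPoints f g A ⊆ A := by
  intro t ht
  by_contra htA
  obtain ⟨a, ha, -⟩ := ht Aᶜ (hA.isOpen_compl.mem_nhds htA)
  exact ha.2 ha.1

/-! ### Homotopy across intervals without essential points -/

/-- `A` is a closed set on which `f` and `g` agree, and the restrictions of `f` and `g` to the
intervals complementary to `A` are homotopic. -/
structure IsGapHomotopic (f g : C(I, X)) (A : Set I) : Prop where
  isClosed : IsClosed A
  eqOn : EqOn f g A
  gap : ∀ a ∈ A, ∀ b ∈ A, a < b → Disjoint (Ioo a b) A → SubpathHomotopic f g a b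

namespace IsGapHomotopic

variable {f g : C(I, X)} {A : Set I}

theorem of_le_or_gap (h : IsGapHomotopic f g A) {a b : I} (ha : a ∈ A) (hb : b ∈ A) (hab : a ≤ b)
    (hd : Disjoint (Ioo a b) A) : SubpathHomotopic f g a b := by
  rcases hab.eq_or_lt with rfl | hab
  · exact .refl (h.eqOn ha)
  · exact h.gap a ha b hb hab hd

/-- The last point `x` before `t` may lie outside `V`. If `x'` lies beyond `t`, the first point `y`
of `A` after `t` is in `V`: from `x` to `y` is a gap or a single point, and from `y` to `x'` the
hypothesis on `V` applies. -/
theorem of_isGreatest (h : IsGapHomotopic f g A) {V : Set I} (hV : V.OrdConnected)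
    (hR : ∀ a ∈ A ∩ V, ∀ b ∈ A ∩ V, SubpathHomotopic f g a b) {a t t' x x' : I} (ht : t ∈ V)
    (ht' : t' ∈ V) (htt' : t ≤ t') (hx : IsGreatest (A ∩ Icc a t) x)
    (hx' : IsGreatest (A ∩ Icc a t') x') : SubpathHomotopic f g x x' := by
  rcases le_or_gt x' t with hle | hlt
  · have : x = x' := le_antisymm (hx'.2 ⟨hx.1.1, hx.1.2.1, hx.1.2.2.trans htt'⟩)
      (hx.2 ⟨hx'.1.1, hx'.1.2.1, hle⟩)
    rw [← this]
    exact .refl (h.eqOn hx.1.1)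
  · obtain ⟨y, hy⟩ := (isCompact_Icc.inter_left h.isClosed : IsCompact (A ∩ Icc t x')).exists_isLeast
      ⟨x', hx'.1.1, hlt.le, le_rfl⟩
    have hyV : y ∈ V := hV.out ht ht' ⟨hy.1.2.1, hy.1.2.2.trans hx'.1.2.2⟩
    have hxV : x' ∈ V := hV.out ht ht' ⟨hlt.le, hx'.1.2.2⟩
    refine (h.of_le_or_gap hx.1.1 hy.1.1 (hx.1.2.2.trans hy.1.2.1) ?_).trans
      (hR y ⟨hy.1.1, hyV⟩ x' ⟨hx'.1.1, hxV⟩)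
    rw [disjoint_left]
    rintro z ⟨hz, hz'⟩ hzA
    rcases le_total z t with hzt | hzt
    · exact hz.not_ge (hx.2 ⟨hzA, hx.1.2.1.trans hz.le, hzt⟩)
    · exact hz'.not_ge (hy.2 ⟨hzA, hzt, hz'.le.trans hy.1.2.2⟩)

/-- Since `t` ranges over the whole interval and not just `A`, each `t` is replaced by the last
point of `A` up to it. The resulting relation holds locally, hence globally by connectedness, and
`a` and `b` represent themselves. -/
theorem of_disjoint_Icc (h : IsGapHomotopic f g A) {a b : I} (ha : a ∈ A) (hb : b ∈ A)
    (hab : a ≤ b) (hd : Disjoint (Icc a b) (essentialPoints f g A)) : SubpathHomotopic f g a b := by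
  have hex : ∀ t ∈ Icc a b, ∃ x, IsGreatest (A ∩ Icc a t) x := fun t ht =>
    (isCompact_Icc.inter_left h.isClosed).exists_isGreatest ⟨a, ha, le_rfl, ht.1⟩
  refine isPreconnected_Icc.induction₂ (fun t t' => ∀ x x', IsGreatest (A ∩ Icc a t) x →
    IsGreatest (A ∩ Icc a t') x' → SubpathHomotopic f g x x') ?_ ?_ ?_
    (left_mem_Icc.2 hab) (right_mem_Icc.2 hab) a b ?_ ?_
  · intro t ht
    obtain ⟨V, hV, hR⟩ := notMem_essentialPoints.1 (disjoint_left.1 hd ht)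
    obtain ⟨c, d, htcd, hcd, hcdV⟩ := exists_Icc_mem_subset_of_mem_nhds hV
    have hR' : ∀ a ∈ A ∩ Icc c d, ∀ b ∈ A ∩ Icc c d, SubpathHomotopic f g a b :=
      fun a ha b hb => hR a ⟨ha.1, hcdV ha.2⟩ b ⟨hb.1, hcdV hb.2⟩
    filter_upwards [mem_nhdsWithin_of_mem_nhds hcd] with t' ht' x x' hx hx'
    rcases le_total t t' with htt' | htt'
    · exact h.of_isGreatest ordConnected_Icc hR' htcd ht' htt' hx hx'
    · exact (h.of_isGreatest ordConnected_Icc hR' ht' htcd htt' hx' hx).symm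
  · intro t₁ t₂ t₃ _ ht₂ _ h₁ h₂ x z hx hz
    obtain ⟨y, hy⟩ := hex t₂ ht₂
    exact (h₁ x y hx hy).trans (h₂ y z hy hz)
  · intro t t' _ _ h₁ x x' hx hx'
    exact (h₁ x' x hx' hx).symm
  · exact ⟨⟨ha, le_rfl, le_rfl⟩, fun z hz => hz.2.2⟩
  · exact ⟨⟨hb, hab, le_rfl⟩, fun z hz => hz.2.2⟩

theorem of_disjoint_ordConnected (h : IsGapHomotopic f g A) {J : Set I} (hJ : J.OrdConnected)
    (hd : Disjoint J (essentialPoints f g A)) {a b : I} (ha : a ∈ A ∩ J) (hb : b ∈ A ∩ J) :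
    SubpathHomotopic f g a b := by
  rcases le_total a b with hab | hab
  · exact h.of_disjoint_Icc ha.1 hb.1 hab (hd.mono_left (hJ.out ha.2 hb.2))
  · exact (h.of_disjoint_Icc hb.1 ha.1 hab (hd.mono_left (hJ.out hb.2 ha.2))).symm

/-- Either `p` is a limit of points of `A` from the right, and the limit lemma applies, or a gap of
`A` starts at `p` and leads to the infimum of those points. -/
theorem of_disjoint_Ioc (hX : HasWellDefinedTransfinitePi1Products X) (h : IsGapHomotopic f g A)
    {p c : I} (hp : p ∈ A) (hc : c ∈ A) (hpc : p < c)
    (hd : Disjoint (Ioc p c) (essentialPoints f g A)) : SubpathHomotopic f g p c := by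
  have hS : ∀ a ∈ A ∩ Ioc p c, ∀ b ∈ A ∩ Ioc p c, SubpathHomotopic f g a b :=
    fun a ha b hb => h.of_disjoint_ordConnected ordConnected_Ioc hd ha hb
  have hcS : c ∈ A ∩ Ioc p c := ⟨hc, hpc, le_rfl⟩
  by_cases hcl : p ∈ closure (A ∩ Ioc p c)
  · exact .of_mem_closure hX hcl (h.eqOn hp) hS hcS
  · have hmem : sInf (A ∩ Ioc p c) ∈ closure (A ∩ Ioc p c) :=
      csInf_mem_closure ⟨c, hcS⟩ (OrderBot.bddBelow _)
    have hmem' : sInf (A ∩ Ioc p c) ∈ A ∩ Icc p c :=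
      closure_minimal (inter_subset_inter_right _ Ioc_subset_Icc_self)
        (h.isClosed.inter isClosed_Icc) hmem
    have hlt : p < sInf (A ∩ Ioc p c) :=
      hmem'.2.1.lt_of_ne fun e => hcl (by rwa [← e] at hmem)
    refine (h.gap p hp _ hmem'.1 hlt ?_).trans (hS _ ⟨hmem'.1, hlt, hmem'.2.2⟩ c hcS)
    rw [disjoint_left]
    rintro z ⟨hz, hz'⟩ hzA
    exact hz'.not_ge (csInf_le (OrderBot.bddBelow _) ⟨hzA, hz, hz'.le.trans hmem'.2.2⟩)

theorem of_disjoint_Ico (hX : HasWellDefinedTransfinitePi1Products X) (h : IsGapHomotopic f g A)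
    {c q : I} (hc : c ∈ A) (hq : q ∈ A) (hcq : c < q)
    (hd : Disjoint (Ico c q) (essentialPoints f g A)) : SubpathHomotopic f g c q := by
  have hS : ∀ a ∈ A ∩ Ico c q, ∀ b ∈ A ∩ Ico c q, SubpathHomotopic f g a b :=
    fun a ha b hb => h.of_disjoint_ordConnected ordConnected_Ico hd ha hb
  have hcS : c ∈ A ∩ Ico c q := ⟨hc, le_rfl, hcq⟩
  by_cases hcl : q ∈ closure (A ∩ Ico c q)
  · exact (SubpathHomotopic.of_mem_closure hX hcl (h.eqOn hq) hS hcS).symm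
  · have hmem : sSup (A ∩ Ico c q) ∈ closure (A ∩ Ico c q) :=
      csSup_mem_closure ⟨c, hcS⟩ (OrderTop.bddAbove _)
    have hmem' : sSup (A ∩ Ico c q) ∈ A ∩ Icc c q :=
      closure_minimal (inter_subset_inter_right _ Ico_subset_Icc_self)
        (h.isClosed.inter isClosed_Icc) hmem
    have hlt : sSup (A ∩ Ico c q) < q :=
      hmem'.2.2.lt_of_ne fun e => hcl (by rwa [e] at hmem)
    refine (hS c hcS _ ⟨hmem'.1, hmem'.2.1, hlt⟩).trans (h.gap _ hmem'.1 q hq hlt ?_)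
    rw [disjoint_left]
    rintro z ⟨hz, hz'⟩ hzA
    exact hz.not_ge (le_csSup (OrderTop.bddAbove _) ⟨hzA, hmem'.2.1.trans hz.le, hz'⟩)

theorem of_disjoint_Ioo (hX : HasWellDefinedTransfinitePi1Products X) (h : IsGapHomotopic f g A)
    {p q : I} (hp : p ∈ A) (hq : q ∈ A) (hpq : p < q)
    (hd : Disjoint (Ioo p q) (essentialPoints f g A)) : SubpathHomotopic f g p q := by
  by_cases hA : Disjoint (Ioo p q) A
  · exact h.gap p hp q hq hpq hA
  · obtain ⟨c, ⟨hpc, hcq⟩, hc⟩ := not_disjoint_iff.1 hA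
    exact (of_disjoint_Ioc hX h hp hc hpc
        (hd.mono_left (Ioc_subset_Ioo_right hcq))).trans
      (of_disjoint_Ico hX h hc hq hcq (hd.mono_left (Ico_subset_Ioo_left hpc)))

/-- Near an isolated essential point `t`, no essential point lies strictly between `t` and a point
of `A`. All nearby points of `A` are thus joined to `t`, hence to each other, and `t` is not
essential. -/
theorem perfect_essentialPoints (hX : HasWellDefinedTransfinitePi1Products X)
    (h : IsGapHomotopic f g A) : Perfect (essentialPoints f g A) := by
  refine ⟨isClosed_essentialPoints f g A, fun t ht => ?_⟩
  by_contra hacc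
  rw [accPt_iff_nhds] at hacc
  push Not at hacc
  obtain ⟨U, hU, hUt⟩ := hacc
  obtain ⟨c, d, htcd, hcd, hcdU⟩ := exists_Icc_mem_subset_of_mem_nhds hU
  have htA := essentialPoints_subset f g h.isClosed ht
  have key : ∀ a ∈ A ∩ Icc c d, SubpathHomotopic f g t a := by
    rintro a ⟨haA, ha⟩
    rcases lt_trichotomy t a with hta | rfl | hat
    · refine of_disjoint_Ioo hX h htA haA hta (disjoint_left.2 fun s hs hs' => hs.1.ne' ?_)
      exact hUt s ⟨hcdU ⟨htcd.1.trans hs.1.le, hs.2.le.trans ha.2⟩, hs'⟩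
    · exact .refl (h.eqOn haA)
    · refine (of_disjoint_Ioo hX h haA htA hat (disjoint_left.2 fun s hs hs' => hs.2.ne ?_)).symm
      exact hUt s ⟨hcdU ⟨ha.1.trans hs.1.le, hs.2.le.trans htcd.2⟩, hs'⟩
  obtain ⟨a, ha, b, hb, hab⟩ := ht _ hcd
  exact hab ((key a ha).symm.trans (key b hb))

/-- If `f` is constant on the part of a gap-homotopic set lying between two of its points, then the
restrictions of `f` and `g` to the segment between these points are homotopic. -/
theorem of_const (hX : HasWellDefinedTransfinitePi1Products X) {B : Set I}
    (h : IsGapHomotopic f g B) (hB : IsNowhereDense B) (h0 : 0 ∈ B) (h1 : 1 ∈ B) {a b : I}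
    (ha : a ∈ B) (hb : b ∈ B) (hab : a ≤ b) {x : X} (hx : ∀ t ∈ B ∩ Icc a b, f t = x) :
    SubpathHomotopic f g a b := by
  -- The product hypothesis speaks of loops on all of `[0,1]`, so both maps are made constant
  -- outside `[a,b]`; the set `S` below adds `0` and `1` to the cut-set.
  let clamp : C(I, I) := ⟨fun t => max a (min b t), by fun_prop⟩
  have hfix : ∀ t ∈ Icc a b, clamp t = t := fun t ht =>
    (max_eq_right (le_min hab ht.1)).trans (min_eq_right ht.2)
  have hclamp0 : clamp 0 = a := by
    change max a (min b 0) = a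
    rw [min_eq_right nonneg', max_eq_left nonneg']
  have hclamp1 : clamp 1 = b := by
    change max a (min b 1) = b
    rw [min_eq_left le_one', max_eq_right hab]
  set S : Set I := insert 0 (insert 1 (B ∩ Icc a b)) with hS
  have hSB : S ⊆ B := by
    rintro t (rfl | rfl | ht)
    exacts [h0, h1, ht.1]
  have hmem : ∀ t ∈ S, clamp t ∈ B ∩ Icc a b := by
    rintro t (rfl | rfl | ht)
    · rw [hclamp0]
      exact ⟨ha, le_rfl, hab⟩
    · rw [hclamp1]
      exact ⟨hb, hab, le_rfl⟩
    · rwa [hfix t ht.2]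
  have hSc : IsClosed S := by
    rw [hS, insert_eq, insert_eq]
    exact isClosed_singleton.union (isClosed_singleton.union (h.isClosed.inter isClosed_Icc))
  have := SubpathHomotopic.of_hasWellDefinedTransfinitePi1Products hX hSc (hB.mono hSB)
    (mem_insert _ _) (mem_insert_of_mem _ (mem_insert _ _)) (f := f.comp clamp) (g := g.comp clamp)
    (x := x) (fun t ht => hx _ (hmem t ht))
    (fun t ht => (h.eqOn (hmem t ht).1).symm.trans (hx _ (hmem t ht))) ?_
  · have := SubpathHomotopic.comp_iff.1 this
    rwa [hclamp0, hclamp1] at this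
  · intro c hc d hd hcd hdisj
    have hmono : clamp c ≤ clamp d := max_le_max le_rfl (min_le_min le_rfl hcd.le)
    refine SubpathHomotopic.comp_iff.2
      (h.of_le_or_gap (hmem c hc).1 (hmem d hd).1 hmono (disjoint_left.2 fun z hz hzB => ?_))
    have hzab : z ∈ Icc a b := ⟨(hmem c hc).2.1.trans hz.1.le, hz.2.le.trans (hmem d hd).2.2⟩
    refine disjoint_left.1 hdisj ⟨?_, ?_⟩ (Or.inr (Or.inr ⟨hzB, hzab⟩))
    · by_contra! hzc
      have : clamp z ≤ clamp c := max_le_max le_rfl (min_le_min le_rfl hzc)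
      rw [hfix z hzab] at this
      exact hz.1.not_ge this
    · by_contra! hzd
      have : clamp d ≤ clamp z := max_le_max le_rfl (min_le_min le_rfl hzd)
      rw [hfix z hzab] at this
      exact hz.2.not_ge this

end IsGapHomotopic

theorem IsHomotopyCutSet.isGapHomotopic {x y : X} {α β : Path x y} {A : Set I}
    (hA : IsHomotopyCutSet α β A) : IsGapHomotopic (α : C(I, X)) (β : C(I, X)) A where
  isClosed := hA.isClosed
  eqOn := fun _ ht => hA.eqOn ht
  gap _ ha _ hb hab hd :=
    (SubpathHomotopic.subpath_iff (hA.eqOn ha) (hA.eqOn hb)).2 (hA.homotopic ha hb hab hd)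

end

/-! ### The theorem -/

theorem theorem3p9 {X : Type*} [TopologicalSpace X]
    (hX : HasWellDefinedTransfinitePi1Products X)
    {x₀ x₁ : X} (α β : Path x₀ x₁) (A : Set unitInterval) (hA : IsHomotopyCutSet α β A) :
    α.Homotopic β ∨
      ∃ P : Set unitInterval, P.Nonempty ∧ Perfect P ∧ P ⊆ A ∧
        IsHomotopyCutSet α β (P ∪ {0, 1}) ∧
        {t ∈ (P ∪ {0, 1}) ∩ Set.Ioo (0 : unitInterval) 1 |
          IsIsolatedPointOf (α '' (P ∪ {0, 1})) (α t)} = ∅ := by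
  have hgap := hA.isGapHomotopic
  set P := essentialPoints (α : C(I, X)) (β : C(I, X)) A with hP
  have hPA : P ⊆ A := essentialPoints_subset _ _ hA.isClosed
  rcases P.eq_empty_or_nonempty with hempty | hne
  · refine Or.inl (SubpathHomotopic.zero_one_iff.1 ?_)
    refine hgap.of_disjoint_Ioo hX hA.zero_mem hA.one_mem zero_lt_one ?_
    rw [← hP, hempty]
    exact disjoint_empty _
  have hBA : P ∪ {0, 1} ⊆ A := by
    rintro t (ht | rfl | rfl)
    exacts [hPA ht, hA.zero_mem, hA.one_mem]
  have h0 : (0 : I) ∈ P ∪ {0, 1} := Or.inr (Or.inl rfl)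
  have h1 : (1 : I) ∈ P ∪ {0, 1} := Or.inr (Or.inr rfl)
  have hB : IsHomotopyCutSet α β (P ∪ {0, 1}) :=
    { isClosed := (isClosed_essentialPoints _ _ _).union (toFinite _).isClosed
      isNowhereDense := hA.isNowhereDense.mono hBA
      zero_mem := h0
      one_mem := h1
      eqOn := fun t ht => hA.eqOn (hBA ht)
      homotopic := fun _ _ ha hb hab hd =>
        (SubpathHomotopic.subpath_iff _ _).1 (hgap.of_disjoint_Ioo hX (hBA ha) (hBA hb) hab
          (hd.mono_right subset_union_left)) }
  refine Or.inr ⟨P, hne, hgap.perfect_essentialPoints hX, hPA, hB, ?_⟩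
  rw [eq_empty_iff_forall_notMem]
  rintro t ⟨⟨htB, ht01⟩, U, hU, hUt⟩
  have htP : t ∈ P := by
    rcases htB with ht | rfl | rfl
    exacts [ht, absurd ht01.1 (lt_irrefl _), absurd ht01.2 (lt_irrefl _)]
  have htU : α t ∈ U := (hUt.symm.subset rfl).1
  obtain ⟨c, d, -, hcd, hcdU⟩ :=
    exists_Icc_mem_subset_of_mem_nhds ((hU.preimage α.continuous).mem_nhds htU)
  have hconst : ∀ s ∈ (P ∪ {0, 1}) ∩ Icc c d, α s = α t := fun s hs =>
    hUt.subset ⟨hcdU hs.2, mem_image_of_mem α hs.1⟩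
  -- Between the first and last points of `P ∪ {0, 1}` in `[a,b]`, `α` is constant on that set; the
  -- two outer pieces have no essential points inside. This contradicts `t ∈ P`.
  have key : ∀ a ∈ A ∩ Icc c d, ∀ b ∈ A ∩ Icc c d, a ≤ b →
      SubpathHomotopic (α : C(I, X)) (β : C(I, X)) a b := by
    rintro a ⟨haA, hac, had⟩ b ⟨hbA, hbc, hbd⟩ hab
    have hcompact : IsCompact ((P ∪ {0, 1}) ∩ Icc a b) := isCompact_Icc.inter_left hB.isClosed
    rcases ((P ∪ {0, 1}) ∩ Icc a b).eq_empty_or_nonempty with hemp | hne'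
    · exact hgap.of_disjoint_Icc haA hbA hab
        (disjoint_left.2 fun s hs hs' => hemp.subset ⟨Or.inl hs', hs⟩)
    obtain ⟨a', ⟨ha'B, ha'⟩, hleast⟩ := hcompact.exists_isLeast hne'
    obtain ⟨b', ⟨hb'B, hb'⟩, hgreatest⟩ := hcompact.exists_isGreatest hne'
    have hmid := hB.isGapHomotopic.of_const hX hB.isNowhereDense h0 h1 ha'B hb'B
      (hleast ⟨hb'B, hb'⟩) (x := α t) fun s hs =>
        hconst s ⟨hs.1, hac.trans (ha'.1.trans hs.2.1), hs.2.2.trans (hb'.2.trans hbd)⟩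
    have hleft : SubpathHomotopic (α : C(I, X)) (β : C(I, X)) a a' := by
      rcases ha'.1.eq_or_lt with rfl | hlt
      · exact .refl (hA.eqOn haA)
      · exact hgap.of_disjoint_Ioo hX haA (hBA ha'B) hlt (disjoint_left.2 fun s hs hs' =>
          hs.2.not_ge (hleast ⟨Or.inl hs', hs.1.le, hs.2.le.trans ha'.2⟩))
    have hright : SubpathHomotopic (α : C(I, X)) (β : C(I, X)) b' b := by
      rcases hb'.2.eq_or_lt with rfl | hlt
      · exact .refl (hA.eqOn hbA)
      · exact hgap.of_disjoint_Ioo hX (hBA hb'B) hbA hlt (disjoint_left.2 fun s hs hs' =>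
          hs.1.not_ge (hgreatest ⟨Or.inl hs', hb'.1.trans hs.1.le, hs.2.le⟩))
    exact (hleft.trans hmid).trans hright
  refine notMem_essentialPoints.2 ⟨_, hcd, fun a ha b hb => ?_⟩ htP
  rcases le_total a b with hab | hab
  · exact key a ha b hb hab
  · exact (key b hb a ha hab).symm
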